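/- Let $A$ be a coherent quantale: a complete lattice with bottom $0$ and top $1$ together with a commutative associative multiplication that distributes over arbitrary joins and has $1$ as unit, such that every element is a join of compact elements, $1$ is compact, and the product of two compact elements is compact. Let $K(A)$ be the set of compact elements of $A$ and $B(A)$ the set of complemented elements of the lattice $A$; the complement of $e\in B(A)$ is unique and is written $\neg e$. An element $p\neq 1$ is $m$-prime if $ab\le p$ implies $a\le p$ or $b\le p$, for all $a,b\in A$. $\mathrm{Spec}(A)$ is the set of $m$-prime elements, with the Zariski topology, whose open sets are the sets $D(a)=\{p\in \mathrm{Spec}(A) : a\not\le p\}$, $a\in A$. $\mathrm{Max}(A)\subseteq \mathrm{Spec}(A)$ is the set of maximal elements of $A\setminus\{1\}$, and $\mathrm{Max}_Z(A)$ is this set with the subspace topology. The radical of $a$ is $\rho(a)=\bigwedge\{p\in \mathrm{Spec}(A): a\le p\}$, and $R(A)=\{a\in A:\rho(a)=a\}$ is the frame of radical elements, ordered as in $A$ (its meets are those of $A$, its joins are the radicals of the joins in $A$), regarded as a quantale whose multiplication is the meet. The reticulation $L(A)$ is the bounded distributive lattice, unique up to isomorphism, that admits a surjection $\lambda:K(A)\to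 L(A)$ with $\lambda(a\vee b)\le\lambda(a)\vee\lambda(b)$, $\lambda(ab)=\lambda(a)\wedge\lambda(b)$, and $\lambda(a)\le\lambda(b)$ if and only if $a^n\le b$ for some $n\ge1$; concretely it is the quotient of $K(A)$ by the relation "each of $a$, $b$ has a power with exponent at least $1$ below the other". A quantale $Q$ is normal if for all $a,b\in Q$ with $a\vee b=1$ there are $e,f\in Q$ with $a\vee e=b\vee f=1$ and $ef=0$. It is $B$-normal if for all $c,d\in K(Q)$ with $c\vee d=1$ there are $e,f\in B(Q)$ with $c\vee e=d\vee f=1$ and $ef=0$. A bounded distributive lattice $L$ is $B$-normal if for all $x,y\in L$ with $x\vee y=1$ there are complemented elements $e,f$ of $L$ with $x\vee e=y\vee f=1$ and $e\wedge f=0$. A space is zero-dimensional if its clopen sets form a basis of its topology, and Boolean if it is compact, Hausdorff and zero-dimensional. An element of $A$ is regular if it is a join of complemented elements. The Pierce spectrum $\mathrm{Sp}(A)$ is the set of maximal elements of the set of regular elements different from $1$, with the topology generated by the sets $U(e)=\{q\in \mathrm{Sp}(A): e\not\le q\}$, $e\in B(A)$. For $p\in \mathrm{Spec}(A)$ put $s_A(p)=\bigvee\{e\in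 B(A): e\le p\}$; this defines a map $s_A:\mathrm{Spec}(A)\to \mathrm{Sp}(A)$. Theorem 7.13. For a coherent quantale $A$ the following are equivalent: 1. $A$ is $B$-normal; 2. $R(A)$ is a $B$-normal frame; 3. the reticulation $L(A)$ is a $B$-normal lattice; 4. for all distinct $p,q\in \mathrm{Max}(A)$ there exists $e\in B(A)$ such that $e\le p$ and $\neg e\le q$; 5. $A$ is a normal quantale and $\mathrm{Max}_Z(A)$ is a zero-dimensional space; 6. $A$ is a normal quantale and $\mathrm{Max}_Z(A)$ is a Boolean space; 7. the family $(D(e)\cap \mathrm{Max}(A))_{e\in B(A)}$ is a basis of open sets for $\mathrm{Max}_Z(A)$; 8. the map $s_A|_{\mathrm{Max}(A)}:\mathrm{Max}_Z(A)\to \mathrm{Sp}(A)$ is a homeomorphism. -/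

import Mathlib

namespace CohQuantale

open TopologicalSpace

/-! ### Coherent quantales

The ambient structure is a commutative monoid on a complete lattice whose product distributes over
arbitrary joins (`IsQuantale`).  The bottom `0` and the top `1` of the lattice are `⊥` and `⊤`. -/

/-- An integral commutative quantale: the top element is the unit of the multiplication. -/
class IsIntegralQuantale (A : Type*) [CompleteLattice A] [CommMonoid A] : Prop
    extends IsQuantale A where
  one_eq_top : (1 : A) = ⊤

/-- A coherent (integral, commutative) quantale: every element is a join of compact elements,
the top is compact, and compact elements are closed under multiplication. -/
class IsCoherentQuantale (A : Type*) [CompleteLattice A] [CommMonoid A] : Prop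
    extends IsIntegralQuantale A, IsCompactlyGenerated A where
  isCompactElement_top : IsCompactElement (⊤ : A)
  isCompactElement_mul : ∀ c d : A, IsCompactElement c → IsCompactElement d →
    IsCompactElement (c * d)

section Basic

variable {A : Type*} [CompleteLattice A] [CommMonoid A] [IsIntegralQuantale A]

theorem mul_le_left' (a b : A) : a * b ≤ a := by
  have h : a * b ≤ a * 1 := by
    gcongr
    rw [IsIntegralQuantale.one_eq_top]; exact le_top
  simpa using h

theorem mul_le_right' (a b : A) : a * b ≤ b := by
  rw [mul_comm]; exact mul_le_left' b a

theorem top_mul' (a : A) : ⊤ * a = a := by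
  rw [← IsIntegralQuantale.one_eq_top, one_mul]

/-- `(a ∨ b)^(n+m) ≤ a^n ∨ b^m`. -/
theorem sup_pow_le (a b : A) : ∀ n m : ℕ, (a ⊔ b) ^ (n + m) ≤ a ^ n ⊔ b ^ m
  | 0, m => by simp [IsIntegralQuantale.one_eq_top]
  | n + 1, 0 => by simp [IsIntegralQuantale.one_eq_top]
  | n + 1, m + 1 => by
    have h1 := sup_pow_le a b n (m + 1)
    have h2 := sup_pow_le a b (n + 1) m
    have e : (a ⊔ b) ^ (n + 1 + (m + 1)) =
        a * (a ⊔ b) ^ (n + (m + 1)) ⊔ b * (a ⊔ b) ^ (n + 1 + m) := by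
      rw [show n + 1 + (m + 1) = (n + (m + 1)) + 1 by omega,
        show n + 1 + m = n + (m + 1) by omega, pow_succ', Quantale.sup_mul_distrib]
    rw [e]
    refine sup_le ?_ ?_
    · calc a * (a ⊔ b) ^ (n + (m + 1)) ≤ a * (a ^ n ⊔ b ^ (m + 1)) := by gcongr
        _ = a ^ (n + 1) ⊔ a * b ^ (m + 1) := by rw [Quantale.mul_sup_distrib, ← pow_succ']
        _ ≤ _ := sup_le_sup_left (mul_le_right' _ _) _
    · calc b * (a ⊔ b) ^ (n + 1 + m) ≤ b * (a ^ (n + 1) ⊔ b ^ m) := by gcongr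
        _ = b * a ^ (n + 1) ⊔ b ^ (m + 1) := by rw [Quantale.mul_sup_distrib, ← pow_succ']
        _ ≤ _ := sup_le_sup_right (mul_le_right' _ _) _

theorem pow_antitone' (a : A) {n m : ℕ} (h : n ≤ m) : a ^ m ≤ a ^ n := by
  obtain ⟨k, rfl⟩ := Nat.exists_eq_add_of_le h
  rw [pow_add]; exact mul_le_left' _ _

end Basic

section Elements

variable {A : Type*} [CompleteLattice A] [CommMonoid A]

/-- `m`-prime elements. -/
def IsMPrime (p : A) : Prop := p ≠ ⊤ ∧ ∀ a b : A, a * b ≤ p → a ≤ p ∨ b ≤ p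

/-- The radical `ρ(a)`: the meet of all `m`-prime elements above `a`. -/
def rad (a : A) : A := sInf {p | IsMPrime p ∧ a ≤ p}

theorem le_rad (a : A) : a ≤ rad a := le_sInf fun _ hp => hp.2

theorem rad_le_of_isMPrime {a p : A} (hp : IsMPrime p) (h : a ≤ p) : rad a ≤ p :=
  sInf_le ⟨hp, h⟩

theorem rad_mono {a b : A} (h : a ≤ b) : rad a ≤ rad b :=
  le_sInf fun _ hp => rad_le_of_isMPrime hp.1 (h.trans hp.2)

theorem rad_rad (a : A) : rad (rad a) = rad a :=
  le_antisymm (le_sInf fun _ hp => rad_le_of_isMPrime hp.1 (rad_le_of_isMPrime hp.1 hp.2))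
    (le_rad _)

theorem rad_inf {a b : A} (ha : rad a = a) (hb : rad b = b) : rad (a ⊓ b) = a ⊓ b :=
  le_antisymm (le_inf ((rad_mono inf_le_left).trans ha.le) ((rad_mono inf_le_right).trans hb.le))
    (le_rad _)

theorem rad_sInf {S : Set A} (h : ∀ a ∈ S, rad a = a) : rad (sInf S) = sInf S :=
  le_antisymm (le_sInf fun a ha => (rad_mono (sInf_le ha)).trans (h a ha).le) (le_rad _)

end Elements

/-! ### Normal and `B`-normal quantales and lattices -/

/-- A normal quantale. -/
def IsNormalQuantale (A : Type*) [CompleteLattice A] [CommMonoid A] : Prop :=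
  ∀ a b : A, a ⊔ b = ⊤ → ∃ e f : A, a ⊔ e = ⊤ ∧ b ⊔ f = ⊤ ∧ e * f = ⊥

/-- A `B`-normal quantale; the elements of the Boolean center are the complemented elements. -/
def IsBNormalQuantale (A : Type*) [CompleteLattice A] [CommMonoid A] : Prop :=
  ∀ c d : A, IsCompactElement c → IsCompactElement d → c ⊔ d = ⊤ →
    ∃ e f : A, IsComplemented e ∧ IsComplemented f ∧ c ⊔ e = ⊤ ∧ d ⊔ f = ⊤ ∧ e * f = ⊥

/-- A `B`-normal (bounded distributive) lattice. -/
def IsBNormalLattice (L : Type*) [DistribLattice L] [BoundedOrder L] : Prop :=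
  ∀ x y : L, x ⊔ y = ⊤ →
    ∃ e f : L, IsComplemented e ∧ IsComplemented f ∧ x ⊔ e = ⊤ ∧ y ⊔ f = ⊤ ∧ e ⊓ f = ⊥

/-! ### The frame of radical elements -/

/-- `R(A)`: the set of radical elements of `A`, ordered as in `A`. -/
def RadicalElements (A : Type*) [CompleteLattice A] [CommMonoid A] : Type _ :=
  {a : A // rad a = a}

namespace RadicalElements

variable {A : Type*} [CompleteLattice A] [CommMonoid A]

instance : PartialOrder (RadicalElements A) := Subtype.partialOrder _

/-- Meets are computed in `A`, joins are the radicals of the joins in `A`. -/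
instance : CompleteLattice (RadicalElements A) where
  sup a b := ⟨rad (a.1 ⊔ b.1), rad_rad _⟩
  le_sup_left a _ := (le_sup_left : a.1 ≤ _).trans (le_rad _)
  le_sup_right _ b := (le_sup_right : b.1 ≤ _).trans (le_rad _)
  sup_le _ _ c h1 h2 := (rad_mono (sup_le h1 h2)).trans c.2.le
  inf a b := ⟨a.1 ⊓ b.1, rad_inf a.2 b.2⟩
  inf_le_left a b := (inf_le_left : a.1 ⊓ b.1 ≤ a.1)
  inf_le_right a b := (inf_le_right : a.1 ⊓ b.1 ≤ b.1)
  le_inf a b c h1 h2 := (le_inf h1 h2 : a.1 ≤ b.1 ⊓ c.1)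
  sSup S := ⟨rad (sSup (Subtype.val '' S)), rad_rad _⟩
  isLUB_sSup S := by
    refine ⟨fun a ha => ?_, fun b hb => ?_⟩
    · exact (le_sSup (Set.mem_image_of_mem Subtype.val ha)).trans (le_rad _)
    · refine (le_trans (rad_mono (sSup_le ?_)) b.2.le : rad (sSup (Subtype.val '' S)) ≤ b.1)
      rintro _ ⟨a, ha, rfl⟩
      exact hb ha
  sInf S := ⟨sInf (Subtype.val '' S), rad_sInf (by rintro _ ⟨a, -, rfl⟩; exact a.2)⟩
  isGLB_sInf S := by
    refine ⟨fun a ha => ?_, fun b hb => ?_⟩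
    · exact sInf_le (Set.mem_image_of_mem Subtype.val ha)
    · refine (le_sInf ?_ : b.1 ≤ _)
      rintro _ ⟨a, ha, rfl⟩
      exact hb ha
  top := ⟨⊤, le_antisymm le_top (le_rad _)⟩
  le_top a := (le_top : a.1 ≤ ⊤)
  bot := ⟨rad ⊥, rad_rad _⟩
  bot_le a := (rad_mono bot_le).trans a.2.le

/-- In `R(A)` finite meets distribute over arbitrary joins. -/
theorem inf_sSup_distrib [IsIntegralQuantale A] (a : RadicalElements A)
    (S : Set (RadicalElements A)) : a ⊓ sSup S = ⨆ b ∈ S, a ⊓ b := by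
  refine le_antisymm ?_ iSup_inf_le_inf_sSup
  set t : RadicalElements A := ⨆ b ∈ S, a ⊓ b with ht
  have key : ∀ b ∈ S, a.1 * b.1 ≤ t.1 := fun b hb => by
    have h : a ⊓ b ≤ t := le_iSup₂_of_le b hb le_rfl
    exact (le_inf (mul_le_left' _ _) (mul_le_right' _ _)).trans (h : a.1 ⊓ b.1 ≤ t.1)
  change a.1 ⊓ rad (sSup (Subtype.val '' S)) ≤ t.1
  rw [← t.2]
  refine le_sInf ?_
  rintro p ⟨hp, htp⟩
  by_cases hap : a.1 ≤ p
  · exact inf_le_left.trans hap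
  · refine inf_le_right.trans (rad_le_of_isMPrime hp (sSup_le ?_))
    rintro _ ⟨b, hb, rfl⟩
    exact (hp.2 _ _ ((key b hb).trans htp)).resolve_left hap

/-- The multiplication of `R(A)` is the meet. -/
instance : CommMonoid (RadicalElements A) where
  mul a b := a ⊓ b
  mul_assoc := inf_assoc
  mul_comm := inf_comm
  one := ⊤
  one_mul := top_inf_eq
  mul_one := inf_top_eq

/-- `R(A)` is a frame, i.e. a quantale whose multiplication is the meet. -/
instance [IsIntegralQuantale A] : IsIntegralQuantale (RadicalElements A) where
  mul_sSup_distrib a S := inf_sSup_distrib a S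
  sSup_mul_distrib S a := by
    refine (inf_comm (sSup S) a).trans ((inf_sSup_distrib a S).trans ?_)
    exact iSup_congr fun b => iSup_congr fun _ => inf_comm a b
  one_eq_top := rfl

end RadicalElements

/-! ### The reticulation -/

/-- `K(A)`: the compact elements of `A`. -/
abbrev Compacts (A : Type*) [CompleteLattice A] : Type _ := {c : A // IsCompactElement c}

/-- A reticulation of `A`: a bounded distributive lattice `L` with a surjection `lam : K(A) → L`
satisfying the three axioms below (binary joins and products of compact elements are compact). -/
structure IsReticulation {A : Type*} [CompleteLattice A] [CommMonoid A]
    {L : Type*} [DistribLattice L] [BoundedOrder L] (lam : Compacts A → L) : Prop where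
  surjective : Function.Surjective lam
  map_sup_le : ∀ a b c : Compacts A, c.1 = a.1 ⊔ b.1 → lam c ≤ lam a ⊔ lam b
  map_mul : ∀ a b c : Compacts A, c.1 = a.1 * b.1 → lam c = lam a ⊓ lam b
  le_iff : ∀ a b : Compacts A, lam a ≤ lam b ↔ ∃ n : ℕ, 1 ≤ n ∧ a.1 ^ n ≤ b.1

section Reticulation

theorem isCompactElement_sup' {A : Type*} [CompleteLattice A] {a b : A}
    (ha : IsCompactElement a) (hb : IsCompactElement b) : IsCompactElement (a ⊔ b) := by
  intro s u hne hd hu h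
  obtain ⟨x, hx, hax⟩ := ha s u hne hd hu (le_sup_left.trans h)
  obtain ⟨y, hy, hby⟩ := hb s u hne hd hu (le_sup_right.trans h)
  obtain ⟨z, hz, hxz, hyz⟩ := hd x hx y hy
  exact ⟨z, hz, sup_le (hax.trans hxz) (hby.trans hyz)⟩

theorem isCompactElement_bot' {A : Type*} [CompleteLattice A] :
    IsCompactElement (⊥ : A) := fun _ _ ⟨x, hx⟩ _ _ _ => ⟨x, hx, bot_le⟩

variable (A : Type*) [CompleteLattice A] [CommMonoid A]

/-- The preorder on `K(A)`: some power (with exponent at least `1`) of `a` lies below `b`. -/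
def PowLE (a b : Compacts A) : Prop := ∃ n : ℕ, 1 ≤ n ∧ a.1 ^ n ≤ b.1

variable {A}

theorem PowLE.of_le {a b : Compacts A} (h : a.1 ≤ b.1) : PowLE A a b := ⟨1, le_rfl, by simpa⟩

/-- The join of two compact elements. -/
def Compacts.sup (a b : Compacts A) : Compacts A := ⟨a.1 ⊔ b.1, isCompactElement_sup' a.2 b.2⟩

theorem powLE_sup_left (a b : Compacts A) : PowLE A a (a.sup b) := .of_le le_sup_left
theorem powLE_sup_right (a b : Compacts A) : PowLE A b (a.sup b) := .of_le le_sup_right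

variable [IsCoherentQuantale A]

theorem PowLE.trans {a b c : Compacts A} (h1 : PowLE A a b) (h2 : PowLE A b c) :
    PowLE A a c := by
  obtain ⟨n, hn, h1⟩ := h1
  obtain ⟨m, hm, h2⟩ := h2
  refine ⟨n * m, Nat.mul_pos hn hm, ?_⟩
  rw [pow_mul]
  exact (pow_le_pow_left' h1 m).trans h2

/-- The product of two compact elements. -/
def Compacts.mul (a b : Compacts A) : Compacts A :=
  ⟨a.1 * b.1, IsCoherentQuantale.isCompactElement_mul _ _ a.2 b.2⟩

theorem PowLE.sup_le {a b c : Compacts A} (h1 : PowLE A a c) (h2 : PowLE A b c) :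
    PowLE A (a.sup b) c := by
  obtain ⟨n, hn, h1⟩ := h1
  obtain ⟨m, hm, h2⟩ := h2
  exact ⟨n + m, by omega, (sup_pow_le _ _ n m).trans (_root_.sup_le h1 h2)⟩

theorem PowLE.le_mul {a b c : Compacts A} (h1 : PowLE A a b) (h2 : PowLE A a c) :
    PowLE A a (b.mul c) := by
  obtain ⟨n, hn, h1⟩ := h1
  obtain ⟨m, hm, h2⟩ := h2
  refine ⟨n + m, by omega, ?_⟩
  rw [pow_add]
  exact mul_le_mul' h1 h2

theorem mul_powLE_left (a b : Compacts A) : PowLE A (a.mul b) a := .of_le (mul_le_left' _ _)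
theorem mul_powLE_right (a b : Compacts A) : PowLE A (a.mul b) b := .of_le (mul_le_right' _ _)

variable (A) in
/-- The equivalence relation on `K(A)` that identifies `a` and `b` when each of them has a power
below the other one. -/
def retSetoid : Setoid (Compacts A) where
  r a b := PowLE A a b ∧ PowLE A b a
  iseqv := ⟨fun _ => ⟨.of_le le_rfl, .of_le le_rfl⟩, fun h => ⟨h.2, h.1⟩,
    fun h1 h2 => ⟨h1.1.trans h2.1, h2.2.trans h1.2⟩⟩

variable (A) in
/-- The reticulation `L(A)`, as the quotient of `K(A)` by the equivalence relation above. -/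
def Reticulation : Type _ := Quotient (retSetoid A)

namespace Reticulation

/-- The canonical map `λ : K(A) → L(A)`. -/
def lam (c : Compacts A) : Reticulation A := Quotient.mk (retSetoid A) c

instance : LE (Reticulation A) where
  le := Quotient.lift₂ (s₁ := retSetoid A) (s₂ := retSetoid A) (PowLE A) fun _ _ _ _ h1 h2 =>
    propext ⟨fun h => (h1.2.trans h).trans h2.1, fun h => (h1.1.trans h).trans h2.2⟩

instance : PartialOrder (Reticulation A) where
  le_refl x := Quotient.inductionOn x fun _ => PowLE.of_le le_rfl
  le_trans x y z := Quotient.inductionOn₃ x y z fun _ _ _ h1 h2 => PowLE.trans h1 h2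
  le_antisymm x y := Quotient.inductionOn₂ x y fun _ _ h1 h2 => Quotient.sound ⟨h1, h2⟩

/-- Joins are induced by joins, and meets by products, of compact elements. -/
instance : DistribLattice (Reticulation A) where
  sup := Quotient.map₂ Compacts.sup fun _ _ h1 _ _ h2 =>
    ⟨(h1.1.trans (powLE_sup_left _ _)).sup_le (h2.1.trans (powLE_sup_right _ _)),
      (h1.2.trans (powLE_sup_left _ _)).sup_le (h2.2.trans (powLE_sup_right _ _))⟩
  le_sup_left x y := Quotient.inductionOn₂ x y powLE_sup_left
  le_sup_right x y := Quotient.inductionOn₂ x y powLE_sup_right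
  sup_le x y z := Quotient.inductionOn₃ x y z fun _ _ _ h1 h2 => PowLE.sup_le h1 h2
  inf := Quotient.map₂ Compacts.mul fun _ _ h1 _ _ h2 =>
    ⟨((mul_powLE_left _ _).trans h1.1).le_mul ((mul_powLE_right _ _).trans h2.1),
      ((mul_powLE_left _ _).trans h1.2).le_mul ((mul_powLE_right _ _).trans h2.2)⟩
  inf_le_left x y := Quotient.inductionOn₂ x y mul_powLE_left
  inf_le_right x y := Quotient.inductionOn₂ x y mul_powLE_right
  le_inf x y z := Quotient.inductionOn₃ x y z fun _ _ _ h1 h2 => PowLE.le_mul h1 h2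
  le_sup_inf x y z := Quotient.inductionOn₃ x y z fun a b c => by
    refine PowLE.of_le ?_
    change (a.1 ⊔ b.1) * (a.1 ⊔ c.1) ≤ a.1 ⊔ b.1 * c.1
    rw [Quantale.sup_mul_distrib, Quantale.mul_sup_distrib (x := b.1)]
    exact sup_le ((mul_le_left' _ _).trans le_sup_left)
      (sup_le ((mul_le_right' _ _).trans le_sup_left) le_sup_right)

instance : BoundedOrder (Reticulation A) where
  top := lam ⟨⊤, IsCoherentQuantale.isCompactElement_top⟩
  le_top x := Quotient.inductionOn x fun _ => PowLE.of_le le_top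
  bot := lam ⟨⊥, isCompactElement_bot'⟩
  bot_le x := Quotient.inductionOn x fun _ => PowLE.of_le bot_le

/-- `L(A)` with the canonical map is a reticulation of `A`. -/
theorem isReticulation : IsReticulation (lam : Compacts A → Reticulation A) where
  surjective := Quotient.mk_surjective
  map_sup_le a b c h := by
    obtain rfl : c = a.sup b := Subtype.ext h
    exact le_rfl
  map_mul a b c h := by
    obtain rfl : c = a.mul b := Subtype.ext h
    rfl
  le_iff _ _ := Iff.rfl

/-- Every reticulation of `A` is isomorphic to `L(A)`, compatibly with the canonical maps. -/
theorem exists_orderIso {L : Type*} [DistribLattice L] [BoundedOrder L] {mu : Compacts A → L}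
    (h : IsReticulation mu) : ∃ φ : Reticulation A ≃o L, ∀ c, φ (lam c) = mu c := by
  choose g hg using h.surjective
  have hle : ∀ a b : Compacts A, mu a ≤ mu b ↔ lam a ≤ lam b := h.le_iff
  let f : Reticulation A → L := Quotient.lift mu fun a b hab =>
    le_antisymm ((hle a b).2 hab.1) ((hle b a).2 hab.2)
  have hf : ∀ c, f (lam c) = mu c := fun _ => rfl
  refine ⟨{ toFun := f, invFun := fun y => lam (g y), left_inv := ?_, right_inv := ?_,
            map_rel_iff' := ?_ }, hf⟩
  · refine fun x => Quotient.inductionOn x fun c => ?_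
    have e : mu (g (mu c)) = mu c := hg _
    exact le_antisymm ((hle _ _).1 e.le) ((hle _ _).1 e.ge)
  · exact fun y => (hf _).trans (hg y)
  · intro x y
    exact Quotient.inductionOn₂ x y fun a b => hle a b

end Reticulation

end Reticulation

/-! ### Spectra -/

section Spectra

variable (A : Type*) [CompleteLattice A] [CommMonoid A]

/-- `Spec(A)`: the `m`-prime elements of `A`. -/
def PrimeSpec : Type _ := {p : A // IsMPrime p}

/-- `Max(A)`: the maximal elements of `A` (maximal among the elements different from `⊤`). -/
def MaxSpec : Type _ := {m : A // IsCoatom m}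

variable {A}

/-- `D(a) = {p ∈ Spec(A) | a ≰ p}`. -/
def D (a : A) : Set (PrimeSpec A) := {p | ¬ a ≤ p.1}

variable [IsIntegralQuantale A]

/-- The Zariski topology on `Spec(A)`: the open sets are the sets `D(a)`, `a ∈ A`. -/
instance : TopologicalSpace (PrimeSpec A) where
  IsOpen U := ∃ a : A, U = D a
  isOpen_univ := ⟨⊤, (Set.eq_univ_of_forall fun p h => p.2.1 (top_le_iff.1 h)).symm⟩
  isOpen_inter := by
    rintro _ _ ⟨a, rfl⟩ ⟨b, rfl⟩
    refine ⟨a * b, Set.ext fun p => ⟨fun h hab => ?_, fun h => ⟨fun ha => ?_, fun hb => ?_⟩⟩⟩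
    · exact (p.2.2 a b hab).elim h.1 h.2
    · exact h ((mul_le_left' a b).trans ha)
    · exact h ((mul_le_right' a b).trans hb)
  isOpen_sUnion := by
    intro S hS
    refine ⟨sSup {a | D a ∈ S}, Set.ext fun p => ⟨?_, fun h => ?_⟩⟩
    · rintro ⟨U, hU, hp⟩ hle
      obtain ⟨a, rfl⟩ := hS U hU
      exact hp ((le_sSup (show a ∈ {a | D a ∈ S} from hU)).trans hle)
    · by_contra hcon
      refine h (sSup_le fun a ha => ?_)
      by_contra hap
      exact hcon ⟨D a, ha, hap⟩

/-- Maximal elements are `m`-prime. -/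
theorem isMPrime_of_isCoatom {m : A} (hm : IsCoatom m) : IsMPrime m := by
  refine ⟨hm.1, fun a b hab => ?_⟩
  by_contra! h
  have ha : m ⊔ a = ⊤ := hm.2 _ (left_lt_sup.2 h.1)
  have hb : m ⊔ b = ⊤ := hm.2 _ (left_lt_sup.2 h.2)
  have : (⊤ : A) ≤ m := by
    calc (⊤ : A) = (m ⊔ a) * (m ⊔ b) := by rw [ha, hb, top_mul']
      _ = m * (m ⊔ b) ⊔ (a * m ⊔ a * b) := by
        rw [Quantale.sup_mul_distrib, Quantale.mul_sup_distrib (x := a)]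
      _ ≤ m := sup_le (mul_le_left' _ _) (sup_le (mul_le_right' _ _) hab)
  exact hm.1 (top_le_iff.1 this)

/-- The inclusion `Max(A) ⊆ Spec(A)`. -/
def MaxSpec.toPrimeSpec (m : MaxSpec A) : PrimeSpec A := ⟨m.1, isMPrime_of_isCoatom m.2⟩

/-- `Max_Z(A)`: the maximal spectrum, as a subspace of `Spec(A)` with the Zariski topology. -/
instance : TopologicalSpace (MaxSpec A) :=
  TopologicalSpace.induced MaxSpec.toPrimeSpec inferInstance

end Spectra

/-! ### The Pierce spectrum -/

section Pierce

variable {A : Type*} [CompleteLattice A]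

/-- Regular elements: joins of complemented elements. -/
def IsRegularElement (a : A) : Prop := ∃ S : Set A, (∀ e ∈ S, IsComplemented e) ∧ sSup S = a

variable (A) in
/-- The Pierce spectrum `Sp(A)`: the max-regular elements of `A`, i.e. the maximal elements of the
set of proper regular elements. -/
def PierceSpec : Type _ := {q : A // Maximal (fun a : A => IsRegularElement a ∧ a ≠ ⊤) q}

/-- The topology of `Sp(A)` generated by the sets `U(e) = {q | e ≰ q}`, `e` complemented. -/
instance : TopologicalSpace (PierceSpec A) :=
  TopologicalSpace.generateFrom
    {U | ∃ e : A, IsComplemented e ∧ U = {q : PierceSpec A | ¬ e ≤ q.1}}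

/-- `s_A(p)`: the join of the complemented elements below `p`. -/
def regularPart (p : A) : A := sSup {e | IsComplemented e ∧ e ≤ p}

theorem regularPart_le (p : A) : regularPart p ≤ p := sSup_le fun _ he => he.2

variable [CommMonoid A] [IsIntegralQuantale A]

/-- `s_A(p)` is max-regular for every `m`-prime element `p`. -/
theorem maximal_regularPart {p : A} (hp : IsMPrime p) :
    Maximal (fun a : A => IsRegularElement a ∧ a ≠ ⊤) (regularPart p) := by
  refine ⟨⟨⟨_, fun e he => he.1, rfl⟩, fun h => hp.1 (top_le_iff.1 (h ▸ regularPart_le p))⟩, ?_⟩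
  rintro q ⟨⟨S, hS, rfl⟩, hq⟩ hle
  refine sSup_le fun e he => ?_
  obtain ⟨f, hf⟩ := hS e he
  have hef : e * f ≤ p := by
    refine le_trans (le_inf (mul_le_left' _ _) (mul_le_right' _ _)) ?_
    rw [hf.inf_eq_bot]; exact bot_le
  rcases hp.2 e f hef with h | h
  · exact le_sSup ⟨hS e he, h⟩
  · exfalso
    have hfq : f ≤ sSup S := le_trans (le_sSup (show f ∈ {e | IsComplemented e ∧ e ≤ p} from
      ⟨⟨e, hf.symm⟩, h⟩)) hle
    exact hq (top_le_iff.1 (hf.sup_eq_top ▸ sup_le (le_sSup he) hfq))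

/-- The map `s_A : Spec(A) → Sp(A)`. -/
def pierceMap (p : PrimeSpec A) : PierceSpec A := ⟨regularPart p.1, maximal_regularPart p.2⟩

end Pierce

/-! ### Topological notions -/

/-- Zero-dimensional spaces: the clopen sets form a basis of the topology. -/
def IsZeroDimensional (X : Type*) [TopologicalSpace X] : Prop :=
  IsTopologicalBasis {U : Set X | IsClopen U}

/-- Boolean spaces: compact Hausdorff zero-dimensional spaces. -/
def IsBooleanSpace (X : Type*) [TopologicalSpace X] : Prop :=
  CompactSpace X ∧ T2Space X ∧ IsZeroDimensional X

end CohQuantale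

namespace CohQuantale

open TopologicalSpace

/-! Everything is routed through condition 4, named `SeparatesCoatoms`: distinct maximal elements
are separated by a complementary pair. Since the top is compact, two rounds of a covering argument
strengthen it to `SeparatesComaximal`: whenever `a ⊔ b = ⊤` there is a complementary pair `e`, `f`
with `a ⊔ e = ⊤` and `b ⊔ f = ⊤`. The other conditions follow from this form.

For the converses, distinct maximal elements are comaximal, so each condition yields a pair that
separates them, though not always a complementary pair in `A`. In `R(A)` and `L(A)` complements are
only complements up to nilpotents. Prime avoidance (`exists_pow_le_of_le_rad`) provides the
nilpotency in `R(A)`, and passing to powers (`isCompl_pow`) then gives genuine complements. On the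
topological side a clopen set gives comaximal elements whose product lies below every maximal
element, and normality replaces them by a pair with product `⊥`. -/

theorem le_regularPart_iff {A : Type*} [CompleteLattice A] {e p : A} (he : IsComplemented e) : e ≤ regularPart p ↔ e ≤ p :=
  ⟨fun h => h.trans (regularPart_le p), fun h => le_sSup ⟨he, h⟩⟩

/-! ### Prime elements and radicals. -/

section Elements

variable {A : Type*} [CompleteLattice A] [CommMonoid A]

theorem IsMPrime.le_of_mul_eq_bot {p a b : A} (hp : IsMPrime p) (h : a * b = ⊥) (ha : ¬ a ≤ p) :
    b ≤ p :=
  (hp.2 a b (h.le.trans bot_le)).resolve_left ha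

theorem IsMPrime.not_le_of_sup_eq_top {p a b : A} (hp : IsMPrime p) (h : a ⊔ b = ⊤) (ha : a ≤ p) :
    ¬ b ≤ p :=
  fun hb => hp.1 (top_le_iff.1 (h ▸ sup_le ha hb))

theorem rad_inf_rad_le (a b : A) : rad a ⊓ rad b ≤ rad (a * b) :=
  le_sInf fun _ hp => (hp.1.2 _ _ hp.2).elim
    (fun h => inf_le_left.trans (rad_le_of_isMPrime hp.1 h))
    (fun h => inf_le_right.trans (rad_le_of_isMPrime hp.1 h))

end Elements

/-! ### Comaximality and complements in an integral quantale. -/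

section Integral

variable {A : Type*} [CompleteLattice A] [CommMonoid A] [IsIntegralQuantale A]

theorem mul_eq_bot_of_disjoint {e f : A} (h : Disjoint e f) : e * f = ⊥ :=
  le_bot_iff.1 ((le_inf (mul_le_left' e f) (mul_le_right' e f)).trans h.le_bot)

theorem le_of_mul_le_of_sup_eq_top {e f s : A} (h : f ⊔ s = ⊤) (hef : e * f ≤ s) : e ≤ s := by
  calc e = (f ⊔ s) * e := by rw [h, top_mul']
    _ = e * f ⊔ s * e := by rw [Quantale.sup_mul_distrib, mul_comm]
    _ ≤ s := sup_le hef (mul_le_left' _ _)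

/-- Multiplying the meet by `e ⊔ f = ⊤` bounds it by copies of `e * f`, so for comaximal elements a
zero product already forces a zero meet. -/
theorem isCompl_of_mul_eq_bot {e f : A} (h : e ⊔ f = ⊤) (hef : e * f = ⊥) : IsCompl e f := by
  refine ⟨disjoint_iff_inf_le.2 ?_, codisjoint_iff.2 h⟩
  calc e ⊓ f = (e ⊔ f) * (e ⊓ f) := by rw [h, top_mul']
    _ = e * (e ⊓ f) ⊔ (e ⊓ f) * f := by rw [Quantale.sup_mul_distrib, mul_comm f]
    _ ≤ e * f ⊔ e * f :=
      sup_le_sup (mul_le_mul' le_rfl inf_le_right) (mul_le_mul' inf_le_left le_rfl)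
    _ ≤ ⊥ := by rw [hef, sup_idem]

theorem sup_mul_eq_top {a x y : A} (hx : a ⊔ x = ⊤) (hy : a ⊔ y = ⊤) : a ⊔ x * y = ⊤ := by
  refine top_le_iff.1 ?_
  calc (⊤ : A) = (a ⊔ x) * (a ⊔ y) := by rw [hx, hy, top_mul']
    _ = a * (a ⊔ y) ⊔ (x * a ⊔ x * y) := by
      rw [Quantale.sup_mul_distrib, Quantale.mul_sup_distrib (x := x)]
    _ ≤ a ⊔ x * y := sup_le ((mul_le_left' _ _).trans le_sup_left)
      (sup_le ((mul_le_right' _ _).trans le_sup_left) le_sup_right)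

theorem top_pow (n : ℕ) : (⊤ : A) ^ n = ⊤ := by
  rw [← IsIntegralQuantale.one_eq_top, one_pow]

/-- Comaximality passes to powers by `sup_pow_le`, so a comaximal pair with nilpotent product
becomes complementary after raising to a power. -/
theorem isCompl_pow {a b : A} (h : a ⊔ b = ⊤) {n : ℕ} (hn : (a * b) ^ n = ⊥) :
    IsCompl (a ^ n) (b ^ n) := by
  refine isCompl_of_mul_eq_bot (top_le_iff.1 ?_) (by rw [← mul_pow, hn])
  have := sup_pow_le a b n n
  rwa [h, top_pow] at this

theorem IsMPrime.le_of_pow_le {p a : A} (hp : IsMPrime p) {n : ℕ} (h : a ^ n ≤ p) : a ≤ p := by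
  induction n with
  | zero =>
    rw [pow_zero, IsIntegralQuantale.one_eq_top] at h
    exact absurd (top_le_iff.1 h) hp.1
  | succ n ih =>
    rw [pow_succ] at h
    exact (hp.2 _ _ h).elim ih id

theorem pow_le_self {a : A} {n : ℕ} (hn : 1 ≤ n) : a ^ n ≤ a := by
  simpa using pow_antitone' a hn

/-- The complements of two elements of the Boolean center multiply to the complement of the join. -/
theorem isCompl_sup_mul {e e' f f' : A} (h : IsCompl e e') (k : IsCompl f f') :
    IsCompl (e ⊔ f) (e' * f') := by
  refine isCompl_of_mul_eq_bot (sup_mul_eq_top ?_ ?_) ?_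
  · exact top_le_iff.1 (h.sup_eq_top ▸ sup_le_sup_right le_sup_left _)
  · exact top_le_iff.1 (k.sup_eq_top ▸ sup_le_sup_right le_sup_right _)
  · rw [Quantale.sup_mul_distrib]
    refine le_bot_iff.1 (sup_le ?_ ?_)
    · rw [← mul_assoc, mul_eq_bot_of_disjoint h.disjoint]; exact mul_le_left' _ _
    · rw [mul_left_comm, mul_eq_bot_of_disjoint k.disjoint]; exact mul_le_right' _ _

end Integral

/-! ### Compactness of the top, prime avoidance and separation. -/

section Coherent

variable {A : Type*} [CompleteLattice A] [CommMonoid A] [IsCoherentQuantale A]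

theorem exists_isCoatom_ge {a : A} (h : a ≠ ⊤) : ∃ m, IsCoatom m ∧ a ≤ m :=
  haveI : IsCoatomic A :=
    CompleteLattice.coatomic_of_top_compact IsCoherentQuantale.isCompactElement_top
  (eq_top_or_exists_le_coatom a).resolve_left h

theorem eq_top_of_forall_isCoatom {a : A} (h : ∀ m, IsCoatom m → ¬ a ≤ m) : a = ⊤ := by
  by_contra ha
  obtain ⟨m, hm, hle⟩ := exists_isCoatom_ge ha
  exact h m hm hle

/-- A proper element lies below a maximal one, which is prime and so also bounds the radical. Hence
comaximality means the same in `R(A)` as in `A`. -/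
theorem rad_eq_top {a : A} (h : rad a = ⊤) : a = ⊤ :=
  eq_top_of_forall_isCoatom fun _ hm hle =>
    hm.1 (top_le_iff.1 (h ▸ rad_le_of_isMPrime (isMPrime_of_isCoatom hm) hle))

/-- If a join of a nonempty directed set is comaximal with `a`, then so is one of its members. -/
theorem exists_sup_eq_top_of_directed {a : A} {S : Set A} (hne : S.Nonempty)
    (hd : DirectedOn (· ≤ ·) S) (h : a ⊔ sSup S = ⊤) : ∃ s ∈ S, a ⊔ s = ⊤ := by
  have hd' : DirectedOn (· ≤ ·) ((a ⊔ ·) '' S) := by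
    rintro _ ⟨x, hx, rfl⟩ _ ⟨y, hy, rfl⟩
    obtain ⟨z, hz, hxz, hyz⟩ := hd x hx y hy
    exact ⟨_, ⟨z, hz, rfl⟩, sup_le_sup_left hxz a, sup_le_sup_left hyz a⟩
  have hle : (⊤ : A) ≤ sSup ((a ⊔ ·) '' S) := by
    obtain ⟨x, hx⟩ := hne
    rw [← h]
    exact sup_le (le_sup_left.trans (le_sSup ⟨x, hx, rfl⟩))
      (sSup_le fun s hs => le_sup_right.trans (le_sSup ⟨s, hs, rfl⟩))
  obtain ⟨_, ⟨s, hs, rfl⟩, hst⟩ := IsCoherentQuantale.isCompactElement_top (A := A) _ _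
    (hne.image _) hd' (isLUB_sSup _) hle
  exact ⟨s, hs, top_le_iff.1 hst⟩

theorem exists_compact_sup_eq_top {a b : A} (h : a ⊔ b = ⊤) :
    ∃ c, IsCompactElement c ∧ c ≤ b ∧ a ⊔ c = ⊤ := by
  obtain ⟨c, hc, hac⟩ := exists_sup_eq_top_of_directed (a := a)
    (S := {c | IsCompactElement c ∧ c ≤ b}) ⟨⊥, isCompactElement_bot', bot_le⟩
    (fun x hx y hy => ⟨x ⊔ y, ⟨isCompactElement_sup' hx.1 hy.1, sup_le hx.2 hy.2⟩,
      le_sup_left, le_sup_right⟩)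
    (by rw [sSup_compact_le_eq, h])
  exact ⟨c, hc.1, hc.2, hac⟩

theorem exists_compact_compact_sup_eq_top {a b : A} (h : a ⊔ b = ⊤) :
    ∃ c d, IsCompactElement c ∧ IsCompactElement d ∧ c ≤ a ∧ d ≤ b ∧ c ⊔ d = ⊤ := by
  obtain ⟨d, hd, hdb, h1⟩ := exists_compact_sup_eq_top h
  obtain ⟨c, hc, hca, h2⟩ := exists_compact_sup_eq_top ((sup_comm d a).trans h1)
  exact ⟨c, d, hc, hd, hca, hdb, (sup_comm c d).trans h2⟩

theorem isCompactElement_pow {c : A} (hc : IsCompactElement c) (n : ℕ) :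
    IsCompactElement (c ^ n) := by
  induction n with
  | zero =>
    rw [pow_zero, IsIntegralQuantale.one_eq_top]
    exact IsCoherentQuantale.isCompactElement_top
  | succ n ih => rw [pow_succ]; exact IsCoherentQuantale.isCompactElement_mul _ _ ih hc

/-- If a directed join contains `e`, it is comaximal with the complement `f`; then so is one member
`s`, and `e = (f ⊔ s) * e ≤ s`. -/
theorem isCompactElement_of_isCompl {e f : A} (h : IsCompl e f) : IsCompactElement e := by
  intro S u hne hd hu hle
  obtain rfl := hu.sSup_eq
  obtain ⟨s, hs, hfs⟩ := exists_sup_eq_top_of_directed (a := f) hne hd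
    (top_le_iff.1 (h.symm.sup_eq_top ▸ sup_le_sup_left hle f))
  exact ⟨s, hs, le_of_mul_le_of_sup_eq_top hfs
    ((mul_eq_bot_of_disjoint h.disjoint).le.trans bot_le)⟩

/-- Prime avoidance: an element containing no power of a compact element `c` lies below an
`m`-prime element not containing `c`. -/
theorem exists_isMPrime_not_le {a c : A} (hc : IsCompactElement c) (h : ∀ n : ℕ, ¬ c ^ n ≤ a) :
    ∃ p, IsMPrime p ∧ a ≤ p ∧ ¬ c ≤ p := by
  obtain ⟨p, hap, hp⟩ := zorn_le_nonempty₀ {x : A | ∀ n : ℕ, ¬ c ^ n ≤ x} (by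
    intro S hS hchain y hy
    refine ⟨sSup S, fun n hn => ?_, fun z hz => le_sSup hz⟩
    obtain ⟨x, hx, hcx⟩ := isCompactElement_pow hc n S _ ⟨y, hy⟩ hchain.directedOn
      (isLUB_sSup S) hn
    exact hS hx n hcx) a h
  -- By maximality of `p`, enlarging it by anything new captures a power of `c`.
  have hlt : ∀ x, ¬ x ≤ p → ∃ n : ℕ, c ^ n ≤ p ⊔ x := fun x hx => by
    by_contra! hcon
    exact hx (le_sup_right.trans (hp.2 hcon le_sup_left))
  refine ⟨p, ⟨fun ht => hp.1 0 (ht ▸ le_top), fun x y hxy => ?_⟩, hap,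
    fun hcp => hp.1 1 (by simpa using hcp)⟩
  by_contra! hcon
  obtain ⟨n, hn⟩ := hlt x hcon.1
  obtain ⟨m, hm⟩ := hlt y hcon.2
  refine hp.1 (n + m) ?_
  calc c ^ (n + m) ≤ (p ⊔ x) * (p ⊔ y) := by rw [pow_add]; exact mul_le_mul' hn hm
    _ = p * (p ⊔ y) ⊔ (x * p ⊔ x * y) := by
      rw [Quantale.sup_mul_distrib, Quantale.mul_sup_distrib (x := x)]
    _ ≤ p := sup_le (mul_le_left' _ _) (sup_le (mul_le_right' _ _) hxy)

theorem exists_pow_le_of_le_rad {a c : A} (hc : IsCompactElement c) (h : c ≤ rad a) :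
    ∃ n : ℕ, c ^ n ≤ a := by
  by_contra! hcon
  obtain ⟨p, hp, hap, hcp⟩ := exists_isMPrime_not_le hc hcon
  exact hcp (h.trans (rad_le_of_isMPrime hp hap))

/-- Complementary elements of the frame of radical elements contain complementary elements. -/
theorem exists_isCompl_le {a b : A} (h : a ⊔ b = ⊤) (hab : a * b ≤ rad ⊥) :
    ∃ e f, IsCompl e f ∧ e ≤ a ∧ f ≤ b := by
  obtain ⟨c, d, hc, hd, hca, hdb, hcd⟩ := exists_compact_compact_sup_eq_top h
  obtain ⟨n, hn⟩ := exists_pow_le_of_le_rad (IsCoherentQuantale.isCompactElement_mul _ _ hc hd)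
    ((mul_le_mul' hca hdb).trans hab)
  -- The exponent `n` may be `0`; a positive one is needed for the powers to stay below `a` and `b`.
  have hn' : (c * d) ^ (n + 1) = ⊥ :=
    le_bot_iff.1 ((pow_antitone' _ n.le_succ).trans hn)
  exact ⟨_, _, isCompl_pow hcd hn', (pow_le_self n.succ_pos).trans hca,
    (pow_le_self n.succ_pos).trans hdb⟩

/-- Any two distinct maximal elements are separated by a complementary pair. -/
def SeparatesCoatoms (A : Type*) [CompleteLattice A] : Prop :=
  ∀ p q : A, IsCoatom p → IsCoatom q → p ≠ q → ∃ e f : A, IsCompl e f ∧ e ≤ p ∧ f ≤ q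

/-- Comaximal elements are separated by a complementary pair. -/
def SeparatesComaximal (A : Type*) [CompleteLattice A] : Prop :=
  ∀ a b : A, a ⊔ b = ⊤ → ∃ e f : A, IsCompl e f ∧ a ⊔ e = ⊤ ∧ b ⊔ f = ⊤

/-- This is the proof that a compact Hausdorff space is normal, carried out in the lattice: first
one point is separated from a closed set, then two closed sets are separated. Compactness of the top
extracts a single member of a directed family each time. -/
theorem SeparatesCoatoms.separatesComaximal (H : SeparatesCoatoms A) :
    SeparatesComaximal A := by
  intro a b hab
  have step : ∀ q, IsCoatom q → b ≤ q → ∃ e f, IsCompl e f ∧ e ≤ q ∧ a ⊔ e = ⊤ := by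
    intro q hq hbq
    obtain ⟨e, ⟨⟨f, hef⟩, heq⟩, hae⟩ := exists_sup_eq_top_of_directed (a := a)
      (S := {e | IsComplemented e ∧ e ≤ q}) ⟨⊥, isComplemented_bot, bot_le⟩
      (fun x ⟨⟨x', hx⟩, hxq⟩ y ⟨⟨y', hy⟩, hyq⟩ =>
        ⟨x ⊔ y, ⟨⟨_, isCompl_sup_mul hx hy⟩, sup_le hxq hyq⟩, le_sup_left, le_sup_right⟩)
      -- A maximal `p` above `a` and above all complemented elements below `q` differs from `q`,
      -- since `b ≤ q`. A pair separating `p` from `q` would then lie entirely below `p`.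
      (eq_top_of_forall_isCoatom fun p hp hle => by
        have hpq : p ≠ q := by
          rintro rfl
          exact hp.1 (top_le_iff.1 (hab ▸ sup_le (le_sup_left.trans hle) hbq))
        obtain ⟨e, f, hef, hep, hfq⟩ := H p q hp hq hpq
        have hfp : f ≤ p := (le_sSup (show f ∈ {e | IsComplemented e ∧ e ≤ q} from
          ⟨⟨e, hef.symm⟩, hfq⟩)).trans (le_sup_right.trans hle)
        exact (isMPrime_of_isCoatom hp).not_le_of_sup_eq_top hef.sup_eq_top hep hfp)
    exact ⟨e, f, hef, heq, hae⟩
  -- The admissible `f` are directed: joining two of them multiplies their complements, which stay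
  -- comaximal with `a`.
  obtain ⟨f, ⟨e, hef, hae⟩, hbf⟩ := exists_sup_eq_top_of_directed (a := b)
    (S := {f | ∃ e, IsCompl e f ∧ a ⊔ e = ⊤}) ⟨⊥, ⊤, isCompl_top_bot, sup_top_eq _⟩
    (fun x ⟨x', hx, hax⟩ y ⟨y', hy, hay⟩ =>
      ⟨x ⊔ y, ⟨_, (isCompl_sup_mul hx.symm hy.symm).symm, sup_mul_eq_top hax hay⟩,
        le_sup_left, le_sup_right⟩)
    (eq_top_of_forall_isCoatom fun q hq hle => by
      obtain ⟨e, f, hef, heq, hae⟩ := step q hq (le_sup_left.trans hle)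
      exact (isMPrime_of_isCoatom hq).not_le_of_sup_eq_top hef.sup_eq_top heq
        ((le_sSup (show f ∈ {f | ∃ e, IsCompl e f ∧ a ⊔ e = ⊤} from ⟨e, hef, hae⟩)).trans
          (le_sup_right.trans hle)))
  exact ⟨e, f, hef, hae, hbf⟩

theorem SeparatesComaximal.isBNormalQuantale (H : SeparatesComaximal A) :
    IsBNormalQuantale A := by
  intro c d _ _ hcd
  obtain ⟨e, f, hef, hc, hd⟩ := H c d hcd
  exact ⟨e, f, ⟨f, hef⟩, ⟨e, hef.symm⟩, hc, hd, mul_eq_bot_of_disjoint hef.disjoint⟩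

theorem SeparatesComaximal.isNormalQuantale (H : SeparatesComaximal A) :
    IsNormalQuantale A := by
  intro c d hcd
  obtain ⟨e, f, hef, hc, hd⟩ := H c d hcd
  exact ⟨e, f, hc, hd, mul_eq_bot_of_disjoint hef.disjoint⟩

theorem IsBNormalQuantale.separatesCoatoms (H : IsBNormalQuantale A) : SeparatesCoatoms A := by
  intro p q hp hq hpq
  obtain ⟨c, d, hc, hd, hcp, hdq, hcd⟩ :=
    exists_compact_compact_sup_eq_top (hp.codisjoint_of_ne hq hpq).eq_top
  obtain ⟨e, f, ⟨e', he⟩, -, hce, hdf, hef⟩ := H c d hc hd hcd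
  have hp' := isMPrime_of_isCoatom hp
  have hq' := isMPrime_of_isCoatom hq
  -- The pair is `e` with its own complement. Since `e ≰ p`, `e' ≤ p`; since `f ≰ q`, `e * f = ⊥`
  -- gives `e ≤ q`.
  refine ⟨e', e, he.symm, ?_, ?_⟩
  · exact hp'.le_of_mul_eq_bot (mul_eq_bot_of_disjoint he.disjoint)
      (hp'.not_le_of_sup_eq_top hce hcp)
  · exact hq'.le_of_mul_eq_bot ((mul_comm f e).trans hef) (hq'.not_le_of_sup_eq_top hdf hdq)

end Coherent

/-! ### Transfer to and from the frame of radical elements. -/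

section Radical

variable {A : Type*} [CompleteLattice A] [CommMonoid A] [IsCoherentQuantale A]

/-- The radical of an element, as an element of the frame of radical elements. -/
def RadicalElements.ofElement (a : A) : RadicalElements A := ⟨rad a, rad_rad a⟩

theorem RadicalElements.sup_eq_top_iff {a b : RadicalElements A} :
    a ⊔ b = ⊤ ↔ a.1 ⊔ b.1 = ⊤ := by
  refine ⟨fun h => rad_eq_top (congrArg Subtype.val h), fun h => ?_⟩
  exact top_le_iff.1 ((h ▸ le_rad (a.1 ⊔ b.1) : (⊤ : A) ≤ rad (a.1 ⊔ b.1)))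

/-- A radical join that contains `c` has a power of `c` below the join taken in `A`. That power is
compact, so it lies below one member `s`, and every prime above `s` then contains `c`. -/
theorem RadicalElements.isCompactElement_ofElement {c : A} (hc : IsCompactElement c) :
    IsCompactElement (RadicalElements.ofElement c) := by
  intro S u hne hd hu hle
  obtain rfl := hu.sSup_eq
  have hle' : c ≤ rad (sSup (Subtype.val '' S)) := (le_rad c).trans hle
  obtain ⟨n, hn⟩ := exists_pow_le_of_le_rad hc hle'
  obtain ⟨_, ⟨s, hs, rfl⟩, hcs⟩ := isCompactElement_pow hc n (Subtype.val '' S) _ (hne.image _)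
    (by
      rintro _ ⟨x, hx, rfl⟩ _ ⟨y, hy, rfl⟩
      obtain ⟨z, hz, hxz, hyz⟩ := hd x hx y hy
      exact ⟨z.1, ⟨z, hz, rfl⟩, hxz, hyz⟩)
    (isLUB_sSup _) hn
  refine ⟨s, hs, ?_⟩
  change rad c ≤ s.1
  rw [← s.2]
  exact le_sInf fun p hp => rad_le_of_isMPrime hp.1 (hp.1.le_of_pow_le (hcs.trans hp.2))

theorem RadicalElements.isCompl_ofElement {e f : A} (h : IsCompl e f) :
    IsCompl (RadicalElements.ofElement e) (RadicalElements.ofElement f) := by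
  refine ⟨disjoint_iff_inf_le.2 ?_, codisjoint_iff.2 (RadicalElements.sup_eq_top_iff.2 ?_)⟩
  · change rad e ⊓ rad f ≤ rad ⊥
    rw [← mul_eq_bot_of_disjoint h.disjoint]
    exact rad_inf_rad_le e f
  · exact top_le_iff.1 (h.sup_eq_top ▸ sup_le_sup (le_rad e) (le_rad f))

theorem SeparatesComaximal.isBNormalQuantale_radicalElements (H : SeparatesComaximal A) :
    IsBNormalQuantale (RadicalElements A) := by
  intro c d _ _ hcd
  obtain ⟨e, f, hef, hc, hd⟩ := H c.1 d.1 (RadicalElements.sup_eq_top_iff.1 hcd)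
  have h := RadicalElements.isCompl_ofElement hef
  exact ⟨_, _, ⟨_, h⟩, ⟨_, h.symm⟩,
    RadicalElements.sup_eq_top_iff.2 (top_le_iff.1 (hc ▸ sup_le_sup_left (le_rad e) _)),
    RadicalElements.sup_eq_top_iff.2 (top_le_iff.1 (hd ▸ sup_le_sup_left (le_rad f) _)),
    h.inf_eq_bot⟩

theorem separatesCoatoms_of_radicalElements (H : IsBNormalQuantale (RadicalElements A)) :
    SeparatesCoatoms A := by
  intro p q hp hq hpq
  have hp' := isMPrime_of_isCoatom hp
  have hq' := isMPrime_of_isCoatom hq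
  obtain ⟨c, d, hc, hd, hcp, hdq, hcd⟩ :=
    exists_compact_compact_sup_eq_top (hp.codisjoint_of_ne hq hpq).eq_top
  obtain ⟨e, f, ⟨e', he⟩, -, hce, hdf, hef⟩ := H _ _
    (RadicalElements.isCompactElement_ofElement hc)
    (RadicalElements.isCompactElement_ofElement hd)
    (RadicalElements.sup_eq_top_iff.2
      (top_le_iff.1 (hcd ▸ sup_le_sup (le_rad c) (le_rad d))))
  have hmul : ∀ x y : RadicalElements A, x ⊓ y = ⊥ → x.1 * y.1 ≤ rad ⊥ := fun x y h =>
    (le_inf (mul_le_left' _ _) (mul_le_right' _ _)).trans (congrArg Subtype.val h).le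
  have hbot : ∀ r : A, IsMPrime r → rad ⊥ ≤ r := fun r hr => rad_le_of_isMPrime hr bot_le
  have hep : ¬ e.1 ≤ p := hp'.not_le_of_sup_eq_top (RadicalElements.sup_eq_top_iff.1 hce)
    (rad_le_of_isMPrime hp' hcp)
  have hfq : ¬ f.1 ≤ q := hq'.not_le_of_sup_eq_top (RadicalElements.sup_eq_top_iff.1 hdf)
    (rad_le_of_isMPrime hq' hdq)
  have he'p := (hp'.2 _ _ ((hmul _ _ he.inf_eq_bot).trans (hbot p hp'))).resolve_left hep
  have heq := (hq'.2 _ _ ((hmul _ _ hef).trans (hbot q hq'))).resolve_right hfq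
  -- Complements in `R(A)` are comaximal in `A` with product below `rad ⊥`, so they can be shrunk to
  -- complements in `A`.
  obtain ⟨x, y, hxy, hx, hy⟩ := exists_isCompl_le
    (RadicalElements.sup_eq_top_iff.1 he.symm.sup_eq_top) (hmul _ _ he.symm.inf_eq_bot)
  exact ⟨x, y, hxy, hx.trans he'p, hy.trans heq⟩

end Radical

/-! ### Transfer to and from the reticulation. -/

section Reticulation

variable {A : Type*} [CompleteLattice A] [CommMonoid A] [IsCoherentQuantale A]

theorem Reticulation.lam_sup_eq_top_iff {a b : Compacts A} :
    lam a ⊔ lam b = ⊤ ↔ a.1 ⊔ b.1 = ⊤ := by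
  constructor
  · intro h
    obtain ⟨n, -, hn⟩ : PowLE A ⟨⊤, IsCoherentQuantale.isCompactElement_top⟩ (a.sup b) :=
      (h.ge : (⊤ : Reticulation A) ≤ lam a ⊔ lam b)
    exact top_le_iff.1 ((top_pow n).ge.trans hn)
  · intro h
    exact top_le_iff.1 (PowLE.of_le h.ge :
      PowLE A ⟨⊤, IsCoherentQuantale.isCompactElement_top⟩ (a.sup b))

theorem Reticulation.lam_inf_eq_bot_iff {a b : Compacts A} :
    lam a ⊓ lam b = ⊥ ↔ ∃ n : ℕ, 1 ≤ n ∧ (a.1 * b.1) ^ n = ⊥ := by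
  constructor
  · intro h
    obtain ⟨n, h1, hn⟩ : PowLE A (a.mul b) ⟨⊥, isCompactElement_bot'⟩ :=
      (h.le : lam a ⊓ lam b ≤ (⊥ : Reticulation A))
    exact ⟨n, h1, le_bot_iff.1 hn⟩
  · rintro ⟨n, h1, hn⟩
    exact le_bot_iff.1 (⟨n, h1, hn.le⟩ : PowLE A (a.mul b) ⟨⊥, isCompactElement_bot'⟩)

theorem SeparatesComaximal.isBNormalLattice_reticulation (H : SeparatesComaximal A) :
    IsBNormalLattice (Reticulation A) := by
  intro x y hxy
  obtain ⟨c, rfl⟩ := Reticulation.isReticulation.surjective x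
  obtain ⟨d, rfl⟩ := Reticulation.isReticulation.surjective y
  obtain ⟨e, f, hef, hc, hd⟩ := H c.1 d.1 (Reticulation.lam_sup_eq_top_iff.1 hxy)
  -- Complemented elements are compact, so they have classes in `L(A)`.
  let e' : Compacts A := ⟨e, isCompactElement_of_isCompl hef⟩
  let f' : Compacts A := ⟨f, isCompactElement_of_isCompl hef.symm⟩
  have hinf : Reticulation.lam e' ⊓ Reticulation.lam f' = ⊥ :=
    Reticulation.lam_inf_eq_bot_iff.2
      ⟨1, le_rfl, (pow_one _).trans (mul_eq_bot_of_disjoint hef.disjoint)⟩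
  have h : IsCompl (Reticulation.lam e') (Reticulation.lam f') :=
    ⟨disjoint_iff.2 hinf, codisjoint_iff.2 (Reticulation.lam_sup_eq_top_iff.2 hef.sup_eq_top)⟩
  exact ⟨_, _, ⟨_, h⟩, ⟨_, h.symm⟩, Reticulation.lam_sup_eq_top_iff.2 hc,
    Reticulation.lam_sup_eq_top_iff.2 hd, hinf⟩

theorem separatesCoatoms_of_reticulation (H : IsBNormalLattice (Reticulation A)) :
    SeparatesCoatoms A := by
  intro p q hp hq hpq
  have hp' := isMPrime_of_isCoatom hp
  have hq' := isMPrime_of_isCoatom hq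
  obtain ⟨c, d, hc, hd, hcp, hdq, hcd⟩ :=
    exists_compact_compact_sup_eq_top (hp.codisjoint_of_ne hq hpq).eq_top
  obtain ⟨x, y, ⟨x', hx⟩, -, hcx, hdy, hxy⟩ :=
    H (Reticulation.lam ⟨c, hc⟩) (Reticulation.lam ⟨d, hd⟩)
      (Reticulation.lam_sup_eq_top_iff.2 hcd)
  obtain ⟨e, rfl⟩ := Reticulation.isReticulation.surjective x
  obtain ⟨f, rfl⟩ := Reticulation.isReticulation.surjective y
  obtain ⟨e', rfl⟩ := Reticulation.isReticulation.surjective x'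
  have hep : ¬ e.1 ≤ p := hp'.not_le_of_sup_eq_top (Reticulation.lam_sup_eq_top_iff.1 hcx) hcp
  have hfq : ¬ f.1 ≤ q := hq'.not_le_of_sup_eq_top (Reticulation.lam_sup_eq_top_iff.1 hdy) hdq
  obtain ⟨n, hn1, hn⟩ := Reticulation.lam_inf_eq_bot_iff.1 hx.symm.inf_eq_bot
  obtain ⟨m, -, hm⟩ := Reticulation.lam_inf_eq_bot_iff.1 hxy
  have hle : ∀ {r a : A} {k : ℕ}, IsMPrime r → a ^ k = ⊥ → a ≤ r := fun hr h =>
    hr.le_of_pow_le (h.le.trans bot_le)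
  -- Representatives of complementary classes have nilpotent product; their `n`-th powers are
  -- complementary in `A`, and `1 ≤ n` keeps them below `p` and `q`.
  exact ⟨_, _, isCompl_pow (Reticulation.lam_sup_eq_top_iff.1 hx.symm.sup_eq_top) hn,
    (pow_le_self hn1).trans ((hp'.2 _ _ (hle hp' hn)).resolve_right hep),
    (pow_le_self hn1).trans ((hq'.2 _ _ (hle hq' hm)).resolve_right hfq)⟩

end Reticulation

/-! ### The maximal spectrum and its map to the Pierce spectrum. -/

section MaximalSpectrum

variable {A : Type*} [CompleteLattice A] [CommMonoid A]

section Integral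

variable [IsIntegralQuantale A]

theorem MaxSpec.isMPrime (m : MaxSpec A) : IsMPrime m.1 := isMPrime_of_isCoatom m.2

theorem MaxSpec.isOpen_iff {U : Set (MaxSpec A)} :
    IsOpen U ↔ ∃ a : A, U = {m | ¬ a ≤ m.1} := by
  constructor
  · rintro ⟨V, ⟨a, rfl⟩, rfl⟩
    exact ⟨a, rfl⟩
  · rintro ⟨a, rfl⟩
    exact ⟨D a, ⟨a, rfl⟩, rfl⟩

theorem MaxSpec.isClopen_of_isCompl {e f : A} (h : IsCompl e f) :
    IsClopen {m : MaxSpec A | ¬ e ≤ m.1} := by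
  refine ⟨⟨MaxSpec.isOpen_iff.2 ⟨f, Set.ext fun m => ?_⟩⟩, MaxSpec.isOpen_iff.2 ⟨e, rfl⟩⟩
  refine ⟨fun he => m.isMPrime.not_le_of_sup_eq_top h.sup_eq_top (not_not.1 he), fun hf he => ?_⟩
  exact hf (m.isMPrime.le_of_mul_eq_bot (mul_eq_bot_of_disjoint h.disjoint) he)

theorem SeparatesCoatoms.t2Space (H : SeparatesCoatoms A) : T2Space (MaxSpec A) := by
  refine ⟨fun p q hpq => ?_⟩
  obtain ⟨e, f, hef, hep, hfq⟩ := H p.1 q.1 p.2 q.2 fun h => hpq (Subtype.ext h)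
  refine ⟨_, _, MaxSpec.isOpen_iff.2 ⟨f, rfl⟩, MaxSpec.isOpen_iff.2 ⟨e, rfl⟩,
    p.isMPrime.not_le_of_sup_eq_top hef.sup_eq_top hep,
    q.isMPrime.not_le_of_sup_eq_top hef.symm.sup_eq_top hfq,
    Set.disjoint_left.2 fun m hf he => ?_⟩
  exact hf (m.isMPrime.le_of_mul_eq_bot (mul_eq_bot_of_disjoint hef.disjoint) he)

theorem SeparatesComaximal.isTopologicalBasis (H : SeparatesComaximal A) :
    IsTopologicalBasis {U : Set (MaxSpec A) | ∃ e : A, IsComplemented e ∧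
      U = MaxSpec.toPrimeSpec ⁻¹' D e} := by
  refine isTopologicalBasis_of_isOpen_of_nhds ?_ ?_
  · rintro _ ⟨e, -, rfl⟩
    exact MaxSpec.isOpen_iff.2 ⟨e, rfl⟩
  · intro p U hp hU
    obtain ⟨a, rfl⟩ := MaxSpec.isOpen_iff.1 hU
    have hpa : p.1 ⊔ a = ⊤ := p.2.2 _ (left_lt_sup.2 hp)
    -- `D(e)` contains `p`, and lies in `D(a)` because a maximal element avoiding `e` contains `f`,
    -- which is comaximal with `a`.
    obtain ⟨e, f, hef, hpe, haf⟩ := H p.1 a hpa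
    refine ⟨_, ⟨e, ⟨f, hef⟩, rfl⟩, p.isMPrime.not_le_of_sup_eq_top hpe le_rfl, ?_⟩
    intro m hm ham
    exact m.isMPrime.not_le_of_sup_eq_top haf ham
      (m.isMPrime.le_of_mul_eq_bot (mul_eq_bot_of_disjoint hef.disjoint) hm)

theorem separatesCoatoms_of_isTopologicalBasis
    (H : IsTopologicalBasis {U : Set (MaxSpec A) | ∃ e : A, IsComplemented e ∧
      U = MaxSpec.toPrimeSpec ⁻¹' D e}) : SeparatesCoatoms A := by
  intro p q hp hq hpq
  have hqp : ¬ p ≤ q := fun h => (hp.le_iff.1 h).elim hq.1 fun h => hpq h.symm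
  -- The neighbourhood `D(p)` of `q` misses `p`, so a basic `D(e)` inside it forces `e ≤ p`.
  obtain ⟨_, ⟨e, ⟨f, hef⟩, rfl⟩, hqe, hsub⟩ := H.exists_subset_of_mem_open
    (a := (⟨q, hq⟩ : MaxSpec A)) (u := {m | ¬ p ≤ m.1}) hqp (MaxSpec.isOpen_iff.2 ⟨p, rfl⟩)
  refine ⟨e, f, hef, ?_, (isMPrime_of_isCoatom hq).le_of_mul_eq_bot
    (mul_eq_bot_of_disjoint hef.disjoint) hqe⟩
  by_contra hep
  exact hsub (show (⟨p, hp⟩ : MaxSpec A) ∈ MaxSpec.toPrimeSpec ⁻¹' D e from hep) le_rfl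

theorem SeparatesComaximal.isZeroDimensional (H : SeparatesComaximal A) :
    IsZeroDimensional (MaxSpec A) := by
  refine isTopologicalBasis_of_isOpen_of_nhds (fun U hU => hU.2) fun p U hp hU => ?_
  obtain ⟨_, ⟨e, ⟨f, hef⟩, rfl⟩, hpe, hsub⟩ :=
    H.isTopologicalBasis.exists_subset_of_mem_open hp hU
  exact ⟨_, MaxSpec.isClopen_of_isCompl hef, hpe, hsub⟩

theorem separatesCoatoms_of_pierceMap_injective
    (H : Function.Injective fun m : MaxSpec A => pierceMap m.toPrimeSpec) :
    SeparatesCoatoms A := by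
  intro p q hp hq hpq
  -- Otherwise the regular part of `p` lies below that of `q`; both are max-regular, so they
  -- coincide, against injectivity.
  have hex : ∃ e, IsComplemented e ∧ e ≤ p ∧ ¬ e ≤ q := by
    by_contra! hcon
    have hle : regularPart p ≤ regularPart q :=
      sSup_le fun e he => le_sSup ⟨he.1, hcon e he.1 he.2⟩
    have heq : regularPart p = regularPart q :=
      le_antisymm hle ((maximal_regularPart (isMPrime_of_isCoatom hp)).2
        (maximal_regularPart (isMPrime_of_isCoatom hq)).1 hle)
    exact hpq (congrArg Subtype.val (@H ⟨p, hp⟩ ⟨q, hq⟩ (Subtype.ext heq)))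
  obtain ⟨e, ⟨f, hef⟩, hep, heq⟩ := hex
  exact ⟨e, f, hef, hep, (isMPrime_of_isCoatom hq).le_of_mul_eq_bot
    (mul_eq_bot_of_disjoint hef.disjoint) heq⟩

theorem continuous_pierceMap_maxSpec :
    Continuous fun m : MaxSpec A => pierceMap m.toPrimeSpec := by
  refine continuous_generateFrom_iff.2 ?_
  rintro _ ⟨e, he, rfl⟩
  exact MaxSpec.isOpen_iff.2 ⟨e, Set.ext fun m => not_congr (le_regularPart_iff he)⟩

theorem SeparatesCoatoms.pierceMap_injective (H : SeparatesCoatoms A) :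
    Function.Injective fun m : MaxSpec A => pierceMap m.toPrimeSpec := by
  intro p q h
  by_contra hpq
  obtain ⟨e, f, hef, hep, hfq⟩ := H p.1 q.1 p.2 q.2 fun h => hpq (Subtype.ext h)
  have h' : regularPart p.1 = regularPart q.1 := congrArg Subtype.val h
  exact q.isMPrime.not_le_of_sup_eq_top hef.symm.sup_eq_top hfq
    ((le_regularPart_iff ⟨f, hef⟩).1 (h' ▸ (le_regularPart_iff ⟨f, hef⟩).2 hep))

end Integral

variable [IsCoherentQuantale A]

/-- The sets `D(a i)` cover exactly when no maximal element contains every `a i`, that is, when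
their join is `⊤`; a finite subjoin then suffices. -/
instance : CompactSpace (MaxSpec A) := by
  refine ⟨isCompact_of_finite_subcover fun {ι} U hU hcov => ?_⟩
  choose a ha using fun i => MaxSpec.isOpen_iff.1 (hU i)
  have hcover : ∀ m : MaxSpec A, ∃ i, ¬ a i ≤ m.1 := fun m => by
    obtain ⟨i, hi⟩ := Set.mem_iUnion.1 (hcov (Set.mem_univ m))
    exact ⟨i, by rwa [ha i] at hi⟩
  classical
  obtain ⟨_, ⟨t, rfl⟩, ht⟩ := exists_sup_eq_top_of_directed (a := (⊥ : A))
    (S := Set.range fun t : Finset ι => t.sup a) (Set.range_nonempty _)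
    (by
      rintro _ ⟨s, rfl⟩ _ ⟨t, rfl⟩
      exact ⟨_, ⟨s ∪ t, rfl⟩, Finset.sup_mono Finset.subset_union_left,
        Finset.sup_mono Finset.subset_union_right⟩)
    (eq_top_of_forall_isCoatom fun m hm hle => by
      obtain ⟨i, hi⟩ := hcover ⟨m, hm⟩
      refine hi (le_trans ?_ (le_sup_right.trans hle))
      exact le_sSup ⟨{i}, Finset.sup_singleton⟩)
  refine ⟨t, fun m _ => ?_⟩
  by_contra hm
  refine m.2.1 (top_le_iff.1 (ht ▸ sup_le bot_le (Finset.sup_le fun i hi => ?_)))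
  by_contra him
  exact hm (Set.mem_iUnion₂.2 ⟨i, hi, by rw [ha i]; exact him⟩)

/-- A clopen `U` around `p` missing `q` is `D(a)` with complement `D(b)`, and `a ⊔ b = ⊤`. Normality
gives `g * h = ⊥` with `g` avoided by maximal elements outside `U` and `h` by those inside, so `g ⊔
h = ⊤` as well. -/
theorem IsNormalQuantale.separatesCoatoms (hN : IsNormalQuantale A)
    (hZ : IsZeroDimensional (MaxSpec A)) : SeparatesCoatoms A := by
  intro p q hp hq hpq
  have hpq' : ¬ q ≤ p := fun h => (hq.le_iff.1 h).elim hp.1 hpq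
  obtain ⟨U, hU, hpU, hsub⟩ := hZ.exists_subset_of_mem_open
    (a := (⟨p, hp⟩ : MaxSpec A)) (u := {m | ¬ q ≤ m.1}) hpq' (MaxSpec.isOpen_iff.2 ⟨q, rfl⟩)
  have hqU : (⟨q, hq⟩ : MaxSpec A) ∉ U := fun h => hsub h le_rfl
  obtain ⟨a, ha⟩ := MaxSpec.isOpen_iff.1 hU.2
  obtain ⟨b, hb⟩ := MaxSpec.isOpen_iff.1 hU.1.isOpen_compl
  have haU : ∀ m : MaxSpec A, m ∉ U → a ≤ m.1 := fun m hm => by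
    rw [ha] at hm; exact not_not.1 hm
  have hbU : ∀ m : MaxSpec A, m ∈ U → b ≤ m.1 := fun m hm => by
    by_contra hcon
    exact (hb ▸ hcon : m ∈ Uᶜ) hm
  have hab : a ⊔ b = ⊤ := eq_top_of_forall_isCoatom fun m hm hle => by
    by_cases hmU : (⟨m, hm⟩ : MaxSpec A) ∈ U
    · rw [ha] at hmU; exact hmU (le_sup_left.trans hle)
    · have : (⟨m, hm⟩ : MaxSpec A) ∈ Uᶜ := hmU
      rw [hb] at this; exact this (le_sup_right.trans hle)
  obtain ⟨g, h, hag, hbh, hgh⟩ := hN a b hab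
  have hin : ∀ m : MaxSpec A, m ∈ U → ¬ h ≤ m.1 := fun m hm =>
    m.isMPrime.not_le_of_sup_eq_top hbh (hbU m hm)
  have hout : ∀ m : MaxSpec A, m ∉ U → ¬ g ≤ m.1 := fun m hm =>
    m.isMPrime.not_le_of_sup_eq_top hag (haU m hm)
  have hsup : g ⊔ h = ⊤ := eq_top_of_forall_isCoatom fun m hm hle => by
    by_cases hmU : (⟨m, hm⟩ : MaxSpec A) ∈ U
    · exact hin _ hmU (le_sup_right.trans hle)
    · exact hout _ hmU (le_sup_left.trans hle)
  exact ⟨g, h, isCompl_of_mul_eq_bot hsup hgh,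
    (isMPrime_of_isCoatom hp).le_of_mul_eq_bot ((mul_comm h g).trans hgh) (hin _ hpU),
    (isMPrime_of_isCoatom hq).le_of_mul_eq_bot hgh (hout _ hqU)⟩

theorem pierceMap_maxSpec_surjective :
    Function.Surjective fun m : MaxSpec A => pierceMap m.toPrimeSpec := by
  rintro ⟨q, hq⟩
  obtain ⟨m, hm, hqm⟩ := exists_isCoatom_ge hq.1.2
  -- Regularity of `q` puts it below the regular part of any maximal element above it; maximality of
  -- `q` gives equality.
  have hle : q ≤ regularPart m := by
    obtain ⟨S, hS, rfl⟩ := hq.1.1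
    exact sSup_le fun e he => le_sSup ⟨hS e he, (le_sSup he).trans hqm⟩
  exact ⟨⟨m, hm⟩, Subtype.ext
    (le_antisymm (hq.2 (maximal_regularPart (isMPrime_of_isCoatom hm)).1 hle) hle)⟩

theorem SeparatesComaximal.isHomeomorph_pierceMap (H : SeparatesComaximal A)
    (hinj : Function.Injective fun m : MaxSpec A => pierceMap m.toPrimeSpec) :
    IsHomeomorph fun m : MaxSpec A => pierceMap m.toPrimeSpec := by
  refine ⟨continuous_pierceMap_maxSpec, H.isTopologicalBasis.isOpenMap_iff.2 ?_, hinj,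
    pierceMap_maxSpec_surjective⟩
  rintro _ ⟨e, he, rfl⟩
  refine isOpen_generateFrom_of_mem ⟨e, he, Set.ext fun q => ?_⟩
  obtain ⟨m, rfl⟩ := pierceMap_maxSpec_surjective q
  -- By bijectivity the image of `D(e)` is exactly `U(e)`.
  exact (hinj.mem_set_image (a := m)).trans (not_congr (le_regularPart_iff he).symm)

end MaximalSpectrum

end CohQuantale

open CohQuantale in
theorem theorem7p13 (A : Type*) [CompleteLattice A] [CommMonoid A]
    [CohQuantale.IsCoherentQuantale A] :
    List.TFAE [
      CohQuantale.IsBNormalQuantale A,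
      CohQuantale.IsBNormalQuantale (CohQuantale.RadicalElements A),
      CohQuantale.IsBNormalLattice (CohQuantale.Reticulation A),
      ∀ p q : A, IsCoatom p → IsCoatom q → p ≠ q →
        ∃ e f : A, IsCompl e f ∧ e ≤ p ∧ f ≤ q,
      CohQuantale.IsNormalQuantale A ∧ CohQuantale.IsZeroDimensional (CohQuantale.MaxSpec A),
      CohQuantale.IsNormalQuantale A ∧ CohQuantale.IsBooleanSpace (CohQuantale.MaxSpec A),
      TopologicalSpace.IsTopologicalBasis
        {U : Set (CohQuantale.MaxSpec A) | ∃ e : A, IsComplemented e ∧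
          U = CohQuantale.MaxSpec.toPrimeSpec ⁻¹' CohQuantale.D e},
      IsHomeomorph
        (fun m : CohQuantale.MaxSpec A => CohQuantale.pierceMap m.toPrimeSpec)] := by
  have key : ∀ H : SeparatesCoatoms A, SeparatesComaximal A := fun H => H.separatesComaximal
  tfae_have 1 → 4 := IsBNormalQuantale.separatesCoatoms
  tfae_have 4 → 1 := fun H => (key H).isBNormalQuantale
  tfae_have 2 → 4 := separatesCoatoms_of_radicalElements
  tfae_have 4 → 2 := fun H => (key H).isBNormalQuantale_radicalElements
  tfae_have 3 → 4 := separatesCoatoms_of_reticulation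
  tfae_have 4 → 3 := fun H => (key H).isBNormalLattice_reticulation
  tfae_have 4 → 6 := fun H => ⟨(key H).isNormalQuantale, inferInstance,
    SeparatesCoatoms.t2Space H, (key H).isZeroDimensional⟩
  tfae_have 6 → 5 := fun H => ⟨H.1, H.2.2.2⟩
  tfae_have 5 → 4 := fun H => H.1.separatesCoatoms H.2
  tfae_have 4 → 7 := fun H => (key H).isTopologicalBasis
  tfae_have 7 → 4 := separatesCoatoms_of_isTopologicalBasis
  tfae_have 4 → 8 := fun H =>
    (key H).isHomeomorph_pierceMap (SeparatesCoatoms.pierceMap_injective H)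
  tfae_have 8 → 4 := fun H => separatesCoatoms_of_pierceMap_injective H.injective
  tfae_finish
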